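/- Consider the index coding problem $(j\,|\,A_j)$, $j\in[1::N]=\{1,\dots,N\}$, with side information sets $A_j\subseteq[1::N]\setminus\{j\}$. A sender encodes independent messages $M_j$, uniformly distributed over $[1::2^{nR_j}]:=\{1,\dots,2^{\lceil nR_j\rceil}\}$ with $R_j\ge 0$, into a string of $n$ bits $x^n(M_1,\dots,M_N)\in\{0,1\}^n$. Receiver $j$ forms an estimate $\hat M_j$ of $M_j$ from $x^n$ and $(M_i)_{i\in A_j}$. The rate tuple $(R_1,\dots,R_N)$ is achievable if there is a sequence of such codes (an encoder and $N$ decoders for each $n$) with $P\{(\hat M_1,\dots,\hat M_N)\ne(M_1,\dots,M_N)\}\to 0$ as $n\to\infty$. For real numbers $S_J\ge 0$, $J\subseteq[1::N]$, and for $K,A\subseteq[1::N]$, let $\mathscr R(K\,|\,A)$ be the set of rate tuples satisfying $$\sum_{i\in J}R_i<\sum_{J'\subseteq K\cup A:\;J'\cap J\neq\emptyset}S_{J'}\qquad\text{for all nonempty } J\subseteq K\setminus A .$$ **Theorem (composite-coding inner bound).** A tuple $(R_1,\dots,R_N)$ of nonnegative rates is achievable for the index coding problem $(j\,|\,A_j)$,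 $j\in[1::N]$, if $$(R_1,\dots,R_N)\in\bigcap_{j\in[1::N]}\ \bigcup_{K_j\subseteq[1::N]:\;j\in K_j}\mathscr R(K_j\,|\,A_j)$$ for some nonnegative $(S_J: J\subseteq[1::N])$ such that $\sum_{J\not\subseteq A_j}S_J\le 1$ for all $j\in[1::N]$. -/

import Mathlib

open scoped BigOperators

namespace IndexCoding

/-- An index code with `N` messages, side information sets `A j`, message alphabets
`Fin (M j)`, and a common noiseless link carrying `n` bits. -/
structure Code {N : ℕ} (A : Fin N → Finset (Fin N)) (M : Fin N → ℕ) (n : ℕ) where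
  /-- The encoder `x^n(m_1, …, m_N)`. -/
  encode : (∀ i, Fin (M i)) → (Fin n → Bool)
  /-- The decoder of receiver `j`: it sees the `n` bits and the messages with index in `A j`. -/
  decode : ∀ j, (Fin n → Bool) → (∀ i : {i // i ∈ A j}, Fin (M i)) → Fin (M j)

/-- The tuple of estimates formed by the receivers when the message tuple `m` is sent. -/
def Code.estimate {N : ℕ} {A : Fin N → Finset (Fin N)} {M : Fin N → ℕ} {n : ℕ}
    (C : Code A M n) (m : ∀ i, Fin (M i)) : ∀ i, Fin (M i) :=
  fun j => C.decode j (C.encode m) (fun i => m i)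

/-- The average probability of error: the probability that the tuple of estimates differs from
the message tuple, when the latter is uniformly distributed. -/
noncomputable def Code.errorProb {N : ℕ} {A : Fin N → Finset (Fin N)} {M : Fin N → ℕ} {n : ℕ}
    (C : Code A M n) : ℝ :=
  ((Finset.univ.filter fun m : (∀ i, Fin (M i)) => C.estimate m ≠ m).card : ℝ) /
    (Fintype.card (∀ i, Fin (M i)) : ℝ)

/-- The size of the message set `[1 : 2^{nR}]`, which is `{1, …, 2^⌈nR⌉}` by the usual
convention for real `nR ≥ 0`. -/
noncomputable def messageCount (R : ℝ) (n : ℕ) : ℕ := 2 ^ ⌈(n : ℝ) * R⌉₊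

/-- The rate tuple `R` is achievable for the index coding problem `(j | A j)`: some sequence of
`(2^{nR_1}, …, 2^{nR_N}, n)` codes has average probability of error tending to zero. -/
def Achievable {N : ℕ} (A : Fin N → Finset (Fin N)) (R : Fin N → ℝ) : Prop :=
  ∃ C : ∀ n : ℕ, Code A (fun i => messageCount (R i) n) n,
    Filter.Tendsto (fun n => (C n).errorProb) Filter.atTop (nhds 0)

/-- The polymatroidal region `𝓡(K | A)` determined by the composite rates `S`. The inequality is
imposed for nonempty `J` only, since for `J = ∅` it would read `0 < 0`. -/
def polymatroidRegion {N : ℕ} (S : Finset (Fin N) → ℝ) (K A : Finset (Fin N)) :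
    Set (Fin N → ℝ) :=
  {R | ∀ J : Finset (Fin N), J ⊆ K \ A → J.Nonempty →
    ∑ i ∈ J, R i <
      ∑ J' ∈ Finset.univ.filter (fun J' : Finset (Fin N) => J' ⊆ K ∪ A ∧ (J' ∩ J).Nonempty), S J'}

end IndexCoding

/-! Linear codes over F₂ suffice, with zero error for large n. Write each message as ⌈nR_i⌉ bits; a
linear map L_J compresses the messages in J to a composite index of ⌊nS_J⌋ bits, and a linear map F
sends all composite indices to n bits. Take two message tuples with the same link string that agree
on A_j. Their composite indices agree for J ⊆ A_j, and F kills no nonzero vector vanishing there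
(`exists_linkMap`), so all composite indices agree. Restricted to K_j ∪ A_j, the message difference
is supported in K_j \ A_j and killed by every L_J with J ⊆ K_j ∪ A_j, hence zero
(`exists_compositeMaps`). Such maps exist by counting: a uniformly random linear map takes a nonzero
vector to a uniform value, so a union bound over the bad vectors applies, and the strict rate
inequalities drive it to zero. -/

namespace IndexCoding

open Filter Topology

/-! ### Counting linear maps that avoid zeros -/

/-- Union bound: if the kernels of finitely many surjective homomorphisms have total density less
than one, then some element lies outside all of them. -/
theorem exists_forall_map_ne_zero {Ω ι : Type*} [AddCommGroup Ω] [Fintype Ω] (D : Finset ι)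
    {Y : ι → Type*} [∀ d, AddCommGroup (Y d)] [∀ d, Fintype (Y d)] (ev : ∀ d, Ω →+ Y d)
    (hev : ∀ d ∈ D, Function.Surjective (ev d))
    (hD : ∑ d ∈ D, (1 : ℝ) / Fintype.card (Y d) < 1) :
    ∃ ω, ∀ d ∈ D, ev d ω ≠ 0 := by
  classical
  by_contra! hcon
  have hker : ∀ d ∈ D, ((Finset.univ.filter fun ω => ev d ω = 0).card : ℝ) =
      Fintype.card Ω * (1 / Fintype.card (Y d)) := by
    intro d hd
    have h1 := AddSubgroup.card_mul_index (ev d).ker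
    rw [AddSubgroup.index_ker, AddMonoidHom.range_eq_top.2 (hev d hd), AddSubgroup.card_top,
      Nat.card_eq_fintype_card, Nat.card_eq_fintype_card, Nat.card_eq_fintype_card] at h1
    have h2 : Fintype.card (ev d).ker = (Finset.univ.filter fun ω => ev d ω = 0).card :=
      Fintype.card_of_subtype _ (by simp [AddMonoidHom.mem_ker])
    rw [h2] at h1
    have h3 : (Fintype.card (Y d) : ℝ) ≠ 0 := by
      exact_mod_cast (Fintype.card_pos (α := Y d)).ne'
    rw [mul_one_div, eq_div_iff h3]
    exact_mod_cast h1
  have hΩ : (0 : ℝ) < Fintype.card Ω := by exact_mod_cast Fintype.card_pos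
  have hcover : (Finset.univ : Finset Ω) ⊆
      D.biUnion fun d => Finset.univ.filter fun ω => ev d ω = 0 := by
    intro ω _
    obtain ⟨d, hd, h0⟩ := hcon ω
    exact Finset.mem_biUnion.2 ⟨d, hd, by simpa using h0⟩
  have hle : (Fintype.card Ω : ℝ) ≤ ∑ d ∈ D, Fintype.card Ω * (1 / Fintype.card (Y d) : ℝ) := by
    rw [← Finset.sum_congr rfl hker]
    exact_mod_cast (Finset.card_le_card hcover).trans Finset.card_biUnion_le
  rw [← Finset.mul_sum] at hle
  nlinarith

/-- Makes evaluation at a nonzero vector surjective, as `exists_forall_map_ne_zero` requires. -/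
theorem exists_linearMap_apply_eq {F V W : Type*} [Field F] [AddCommGroup V] [Module F V]
    [AddCommGroup W] [Module F W] {v : V} (hv : v ≠ 0) (w : W) : ∃ f : V →ₗ[F] W, f v = w := by
  obtain ⟨φ, hφ⟩ : ∃ φ : Module.Dual F V, φ v ≠ 0 := by
    by_contra! h
    exact hv ((Module.forall_dual_apply_eq_zero_iff F v).1 h)
  exact ⟨φ.smulRight ((φ v)⁻¹ • w), by simp [smul_smul, hφ]⟩

/-! ### Good composite and link maps -/

/-- Keep the coordinates in `J` and set all others to zero. -/
def mask {N : ℕ} {V : Fin N → Type*} [∀ i, Zero (V i)] (J : Finset (Fin N)) (m : ∀ i, V i) :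
    ∀ i, V i :=
  fun i => if i ∈ J then m i else 0

theorem card_piFinset_support {ι : Type*} [Fintype ι] [DecidableEq ι] (k : ι → ℕ) (T : Finset ι) :
    (Fintype.piFinset fun i => if i ∈ T then Finset.univ else ({0} : Finset (Fin (k i) → ZMod 2))).card
      = 2 ^ ∑ i ∈ T, k i := by
  rw [Fintype.card_piFinset, ← Finset.prod_pow_eq_pow_sum,
    ← Finset.prod_subset (Finset.subset_univ T)]
  · refine Finset.prod_congr rfl fun i hi => ?_
    simp [hi, ZMod.card]
  · intro i _ hi
    simp [hi]

theorem card_pi_bits {ι : Type*} [Fintype ι] [DecidableEq ι] (s : ι → ℕ) :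
    Fintype.card (∀ i, Fin (s i) → ZMod 2) = 2 ^ ∑ i, s i := by
  simp [Fintype.card_pi, ZMod.card, Finset.prod_pow_eq_pow_sum]

/-- The composite indices `J` that receiver `j` uses when the messages with index in `T` are in
doubt. -/
def usedIndices {N : ℕ} (B T : Finset (Fin N)) : Finset (Finset (Fin N)) :=
  Finset.univ.filter fun J => J ⊆ B ∧ (J ∩ T).Nonempty

/-- Group the differences d by exact support T: there are at most 2^(∑_{i∈T} k i) of them. Only the
J meeting T see a nonzero masked d, and their values are independent and uniform, so all vanish with
probability 2^(-∑ s J). -/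
theorem exists_compositeMaps {N : ℕ} (k : Fin N → ℕ) (s : Finset (Fin N) → ℕ)
    (A K : Fin N → Finset (Fin N))
    (h : ∑ j, ∑ T ∈ (K j \ A j).powerset.filter Finset.Nonempty,
      (2 : ℝ) ^ (∑ i ∈ T, k i) / 2 ^ (∑ J ∈ usedIndices (K j ∪ A j) T, s J) < 1) :
    ∃ L : ∀ J, (∀ i, Fin (k i) → ZMod 2) →ₗ[ZMod 2] (Fin (s J) → ZMod 2),
      ∀ j, ∀ d : (∀ i, Fin (k i) → ZMod 2), d ≠ 0 → (∀ i ∉ K j \ A j, d i = 0) →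
        ∃ J ⊆ K j ∪ A j, L J (mask J d) ≠ 0 := by
  classical
  let D : Finset (Σ _ : Fin N, Σ _ : Finset (Fin N), ∀ i, Fin (k i) → ZMod 2) :=
    Finset.univ.sigma fun j => ((K j \ A j).powerset.filter Finset.Nonempty).sigma fun T =>
      (Fintype.piFinset fun i =>
        if i ∈ T then Finset.univ else ({0} : Finset (Fin (k i) → ZMod 2))).filter
        fun d => ∀ i ∈ T, d i ≠ 0
  let ev : ∀ x : (Σ _ : Fin N, Σ _ : Finset (Fin N), ∀ i, Fin (k i) → ZMod 2),
      (∀ J, (∀ i, Fin (k i) → ZMod 2) →ₗ[ZMod 2] (Fin (s J) → ZMod 2)) →+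
        (∀ J : usedIndices (K x.1 ∪ A x.1) x.2.1, Fin (s J) → ZMod 2) := fun x =>
    { toFun := fun L J => L J (mask J.1 x.2.2)
      map_zero' := by ext; simp
      map_add' := by intros; ext; simp }
  have : ∀ J, Fintype ((∀ i, Fin (k i) → ZMod 2) →ₗ[ZMod 2] (Fin (s J) → ZMod 2)) := fun J =>
    Fintype.ofInjective _ DFunLike.coe_injective
  have key : ∃ L, ∀ d ∈ D, ev d L ≠ 0 := by
    refine exists_forall_map_ne_zero D ev ?_ ?_
    · rintro ⟨j, T, d⟩ hx y
      simp only [D, Finset.mem_sigma, Finset.mem_filter] at hx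
      have hex : ∀ J : usedIndices (K j ∪ A j) T,
          ∃ f : (∀ i, Fin (k i) → ZMod 2) →ₗ[ZMod 2] (Fin (s J) → ZMod 2),
            f (mask J.1 d) = y J := by
        intro J
        refine exists_linearMap_apply_eq (fun h0 => ?_) _
        obtain ⟨i, hi⟩ := (Finset.mem_filter.1 J.2).2.2
        rw [Finset.mem_inter] at hi
        have := congrFun h0 i
        simp only [mask, hi.1, if_true] at this
        exact hx.2.2.2 i hi.2 this
      choose f hf using hex
      refine ⟨fun J => if hJ : J ∈ usedIndices (K j ∪ A j) T then f ⟨J, hJ⟩ else 0, ?_⟩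
      funext J
      simp only [ev, AddMonoidHom.coe_mk, ZeroHom.coe_mk]
      rw [dif_pos J.2]
      exact hf J
    · refine lt_of_le_of_lt ?_ h
      rw [Finset.sum_sigma]
      refine Finset.sum_le_sum fun j _ => ?_
      rw [Finset.sum_sigma]
      refine Finset.sum_le_sum fun T _ => ?_
      have hcard : Fintype.card (∀ J : usedIndices (K j ∪ A j) T, Fin (s J) → ZMod 2) =
          2 ^ ∑ J ∈ usedIndices (K j ∪ A j) T, s J := by
        rw [card_pi_bits, Finset.sum_coe_sort (usedIndices (K j ∪ A j) T) s]
      refine (Finset.sum_congr rfl fun d _ => by rw [hcard]).le.trans (b :=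
        ∑ d ∈ _, (1 : ℝ) / (2 ^ ∑ J ∈ usedIndices (K j ∪ A j) T, s J : ℕ)) ?_
      rw [Finset.sum_const, nsmul_eq_mul, mul_one_div]
      push_cast
      gcongr
      refine le_trans (Nat.cast_le.2 (Finset.card_filter_le _ _)) ?_
      rw [card_piFinset_support]
      push_cast
      exact le_rfl
  obtain ⟨L, hL⟩ := key
  refine ⟨L, fun j d hd hsupp => ?_⟩
  -- T is the exact support of d.
  have hx : (⟨j, Finset.univ.filter fun i => d i ≠ 0, d⟩ :
      Σ _ : Fin N, Σ _ : Finset (Fin N), ∀ i, Fin (k i) → ZMod 2) ∈ D := by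
    simp only [D, Finset.mem_sigma, Finset.mem_univ, true_and, Finset.mem_filter,
      Finset.mem_powerset, Fintype.mem_piFinset]
    refine ⟨⟨fun i hi => ?_, ?_⟩, fun i => ?_, fun i hi => hi⟩
    · by_contra hni
      exact (Finset.mem_filter.1 hi).2 (hsupp i hni)
    · obtain ⟨i, hi⟩ := Function.ne_iff.1 hd
      exact ⟨i, by simpa using hi⟩
    · split_ifs with hi
      · exact Finset.mem_univ _
      · simpa using hi
  obtain ⟨J, hJ⟩ := Function.ne_iff.1 (hL _ hx)
  exact ⟨J.1, (Finset.mem_filter.1 J.2).2.1, hJ⟩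

theorem exists_linkMap {N n : ℕ} (s : Finset (Fin N) → ℕ) (A : Fin N → Finset (Fin N))
    (h : ∑ j, (2 : ℝ) ^ (∑ J ∈ Finset.univ.filter (fun J => ¬ J ⊆ A j), s J) / 2 ^ n < 1) :
    ∃ F : (∀ J, Fin (s J) → ZMod 2) →ₗ[ZMod 2] (Fin n → ZMod 2),
      ∀ j, ∀ w : (∀ J, Fin (s J) → ZMod 2), w ≠ 0 → (∀ J ⊆ A j, w J = 0) → F w ≠ 0 := by
  classical
  let D : Finset (Σ _ : Fin N, ∀ J, Fin (s J) → ZMod 2) :=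
    Finset.univ.sigma fun j =>
      (Fintype.piFinset fun J => if J ∈ Finset.univ.filter (fun J => ¬ J ⊆ A j)
        then Finset.univ else ({0} : Finset (Fin (s J) → ZMod 2))).filter fun w => w ≠ 0
  let ev : ∀ _ : (Σ _ : Fin N, ∀ J, Fin (s J) → ZMod 2),
      ((∀ J, Fin (s J) → ZMod 2) →ₗ[ZMod 2] (Fin n → ZMod 2)) →+ (Fin n → ZMod 2) := fun x =>
    { toFun := fun F => F x.2
      map_zero' := by simp
      map_add' := by intros; simp }
  have : Fintype ((∀ J, Fin (s J) → ZMod 2) →ₗ[ZMod 2] (Fin n → ZMod 2)) :=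
    Fintype.ofInjective _ DFunLike.coe_injective
  have key : ∃ F, ∀ d ∈ D, ev d F ≠ 0 := by
    refine exists_forall_map_ne_zero D ev ?_ ?_
    · rintro ⟨j, w⟩ hx y
      simp only [D, Finset.mem_sigma, Finset.mem_filter] at hx
      exact exists_linearMap_apply_eq hx.2.2 y
    · refine lt_of_le_of_lt ?_ h
      rw [Finset.sum_sigma]
      refine Finset.sum_le_sum fun j _ => ?_
      have hcard : Fintype.card (Fin n → ZMod 2) = 2 ^ n := by simp [ZMod.card]
      simp only [hcard, Finset.sum_const, nsmul_eq_mul, mul_one_div]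
      push_cast
      gcongr
      refine le_trans (Nat.cast_le.2 (Finset.card_filter_le _ _)) ?_
      rw [card_piFinset_support]
      push_cast
      exact le_rfl
  obtain ⟨F, hF⟩ := key
  refine ⟨F, fun j w hw hsupp => hF ⟨j, w⟩ ?_⟩
  simp only [D, Finset.mem_sigma, Finset.mem_univ, true_and, Finset.mem_filter,
    Fintype.mem_piFinset]
  refine ⟨fun J => ?_, hw⟩
  split_ifs with hJ
  · exact Finset.mem_singleton.2 (hsupp J hJ)
  · exact Finset.mem_univ _

/-! ### Zero-error codes at a fixed block length -/

/-- If the link string and the side information determine the desired message at every receiver,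
then some choice of decoders makes no error. -/
theorem exists_code_of_determined {N n : ℕ} {A : Fin N → Finset (Fin N)} {M : Fin N → ℕ}
    (hM : ∀ i, 0 < M i) (x : (∀ i, Fin (M i)) → (Fin n → Bool))
    (hx : ∀ j m m', x m = x m' → (∀ i ∈ A j, m i = m' i) → m j = m' j) :
    ∃ C : Code A M n, C.errorProb = 0 := by
  classical
  let C : Code A M n :=
    { encode := x
      decode := fun j b a =>
        if h : ∃ m, x m = b ∧ (fun i : {i // i ∈ A j} => m i) = a then h.choose j
        else ⟨0, hM j⟩ }
  have hC : ∀ m, C.estimate m = m := by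
    intro m
    funext j
    have hex : ∃ m', x m' = x m ∧
        (fun i : {i // i ∈ A j} => m' i) = fun i : {i // i ∈ A j} => m i := ⟨m, rfl, rfl⟩
    have hdec : C.estimate m j = hex.choose j := dif_pos hex
    rw [hdec]
    exact hx j _ _ hex.choose_spec.1 fun i hi => congrFun hex.choose_spec.2 ⟨i, hi⟩
  exact ⟨C, by simp [Code.errorProb, hC]⟩

theorem exists_code_of_sum_lt_one {N n : ℕ} {A : Fin N → Finset (Fin N)} (k : Fin N → ℕ)
    (s : Finset (Fin N) → ℕ) (K : Fin N → Finset (Fin N))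
    (hK : ∀ j, j ∈ K j)
    (hcomp : ∑ j, ∑ T ∈ (K j \ A j).powerset.filter Finset.Nonempty,
      (2 : ℝ) ^ (∑ i ∈ T, k i) / 2 ^ (∑ J ∈ usedIndices (K j ∪ A j) T, s J) < 1)
    (hlink : ∑ j, (2 : ℝ) ^ (∑ J ∈ Finset.univ.filter (fun J => ¬ J ⊆ A j), s J) / 2 ^ n < 1) :
    ∃ C : Code A (fun i => 2 ^ k i) n, C.errorProb = 0 := by
  classical
  obtain ⟨L, hL⟩ := exists_compositeMaps k s A K hcomp
  obtain ⟨F, hF⟩ := exists_linkMap s A hlink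
  let e : ∀ i, Fin (2 ^ k i) ≃ (Fin (k i) → ZMod 2) := fun i =>
    Fintype.equivOfCardEq (by simp [ZMod.card])
  let b : (Fin n → ZMod 2) ≃ (Fin n → Bool) := Fintype.equivOfCardEq (by simp [ZMod.card])
  let v : (∀ i, Fin (2 ^ k i)) → ∀ i, Fin (k i) → ZMod 2 := fun m i => e i (m i)
  let W : (∀ i, Fin (2 ^ k i)) → ∀ J, Fin (s J) → ZMod 2 := fun m J => L J (mask J (v m))
  refine exists_code_of_determined (fun i => by positivity) (fun m => b (F (W m)))
    fun j m m' hmm hside => ?_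
  have hvA : ∀ i ∈ A j, v m i = v m' i := fun i hi => congrArg (e i) (hside i hi)
  have hW : W m - W m' = 0 := by
    by_contra hne
    refine hF j _ hne (fun J hJ => ?_) (by rw [map_sub, b.injective hmm, sub_self])
    have hmask : mask J (v m) = mask J (v m') := by
      funext i
      by_cases hi : i ∈ J
      · simp [mask, hi, hvA i (hJ hi)]
      · simp [mask, hi]
    simp [W, hmask]
  by_contra hj
  -- Masking discards the unknown differences outside K j ∪ A j; no J ⊆ K j ∪ A j sees them.
  have key : ∃ J ⊆ K j ∪ A j, L J (mask J (mask (K j ∪ A j) (v m - v m'))) ≠ 0 := by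
    refine hL j _ ?_ ?_
    · refine Function.ne_iff.2 ⟨j, ?_⟩
      have hjK : j ∈ K j ∪ A j := Finset.mem_union_left _ (hK j)
      simp only [mask, hjK, if_true, Pi.sub_apply, Pi.zero_apply]
      exact sub_ne_zero.2 fun h => hj ((e j).injective h)
    · intro i hi
      by_cases hiA : i ∈ A j
      · simp [mask, hvA i hiA]
      · have : i ∉ K j ∪ A j := by
          simp only [Finset.mem_sdiff, Finset.mem_union] at hi ⊢
          tauto
        simp only [mask, this, if_false]
  obtain ⟨J, hJ, hne⟩ := key
  refine hne ?_
  have hmask : mask J (mask (K j ∪ A j) (v m - v m')) = mask J (v m) - mask J (v m') := by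
    funext i
    by_cases hi : i ∈ J
    · have := hJ hi
      simp only [mask, Pi.sub_apply, hi, this, if_true]
    · simp [mask, hi]
  rw [hmask, map_sub]
  exact congrFun hW J

/-! ### Asymptotics in the block length -/

/-- If the exponents `p n`, `q n` grow at linear rates `a < b` up to bounded deviations, then the
ratio of powers of two tends to zero. -/
theorem tendsto_two_pow_div {p q : ℕ → ℕ} {a b C : ℝ} (hab : a < b)
    (hp : ∀ n, (p n : ℝ) ≤ a * n + C) (hq : ∀ n, b * n - C ≤ (q n : ℝ)) :
    Tendsto (fun n => (2 : ℝ) ^ p n / 2 ^ q n) atTop (𝓝 0) := by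
  have hlim : Tendsto (fun n : ℕ => (2 : ℝ) ^ (2 * C) * ((2 : ℝ) ^ (a - b)) ^ n) atTop (𝓝 0) := by
    rw [← mul_zero ((2 : ℝ) ^ (2 * C))]
    refine Tendsto.const_mul _ (tendsto_pow_atTop_nhds_zero_of_lt_one (by positivity) ?_)
    exact Real.rpow_lt_one_of_one_lt_of_neg one_lt_two (by linarith)
  refine squeeze_zero (fun n => by positivity) (fun n => ?_) hlim
  rw [← Real.rpow_natCast, ← Real.rpow_natCast, ← Real.rpow_natCast, ← Real.rpow_sub two_pos,
    ← Real.rpow_mul two_pos.le, ← Real.rpow_add two_pos]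
  exact Real.rpow_le_rpow_of_exponent_le one_le_two (by linarith [hp n, hq n])

theorem tendsto_sum_zero {α ι : Type*} {l : Filter α} {T : Finset ι} {f : ι → α → ℝ}
    (h : ∀ i ∈ T, Tendsto (f i) l (𝓝 0)) : Tendsto (fun x => ∑ i ∈ T, f i x) l (𝓝 0) := by
  simpa using tendsto_finsetSum T h

theorem sum_ceil_le {ι : Type*} (T : Finset ι) {R : ι → ℝ} (hR : ∀ i, 0 ≤ R i) (n : ℕ) :
    ((∑ i ∈ T, ⌈(n : ℝ) * R i⌉₊ : ℕ) : ℝ) ≤ (∑ i ∈ T, R i) * n + T.card := by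
  push_cast
  rw [Finset.sum_mul, Finset.card_eq_sum_ones, Nat.cast_sum, ← Finset.sum_add_distrib]
  refine Finset.sum_le_sum fun i _ => ?_
  have := (Nat.ceil_lt_add_one (mul_nonneg n.cast_nonneg (hR i))).le
  push_cast
  linarith

theorem le_sum_floor {ι : Type*} (T : Finset ι) (S : ι → ℝ) (n : ℕ) :
    (∑ i ∈ T, S i) * n - T.card ≤ ((∑ i ∈ T, ⌊(n : ℝ) * S i⌋₊ : ℕ) : ℝ) := by
  push_cast
  rw [Finset.sum_mul, Finset.card_eq_sum_ones, Nat.cast_sum, ← Finset.sum_sub_distrib]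
  refine Finset.sum_le_sum fun i _ => ?_
  have := Nat.sub_one_lt_floor ((n : ℝ) * S i)
  push_cast
  linarith

theorem sum_floor_le {ι : Type*} (T : Finset ι) {S : ι → ℝ} (hS : ∀ i, 0 ≤ S i) (n : ℕ) :
    ((∑ i ∈ T, ⌊(n : ℝ) * S i⌋₊ : ℕ) : ℝ) ≤ (∑ i ∈ T, S i) * n := by
  push_cast
  rw [Finset.sum_mul]
  refine Finset.sum_le_sum fun i _ => ?_
  have := Nat.floor_le (mul_nonneg n.cast_nonneg (hS i))
  linarith

/-- The inner bound under a strict link constraint: codes of large block length make no error. -/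
theorem eventually_exists_code {N : ℕ} {A K : Fin N → Finset (Fin N)}
    (hK : ∀ j, j ∈ K j) {R : Fin N → ℝ} (hR : ∀ j, 0 ≤ R j) {S : Finset (Fin N) → ℝ}
    (hS : ∀ J, 0 ≤ S J)
    (hlink : ∀ j, ∑ J ∈ Finset.univ.filter (fun J => ¬ J ⊆ A j), S J < 1)
    (hreg : ∀ j, R ∈ polymatroidRegion S (K j) (A j)) :
    ∀ᶠ n in atTop, ∃ C : Code A (fun i => messageCount (R i) n) n, C.errorProb = 0 := by
  have hcomp : Tendsto (fun n : ℕ => ∑ j, ∑ T ∈ (K j \ A j).powerset.filter Finset.Nonempty,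
      (2 : ℝ) ^ (∑ i ∈ T, ⌈(n : ℝ) * R i⌉₊) /
        2 ^ (∑ J ∈ usedIndices (K j ∪ A j) T, ⌊(n : ℝ) * S J⌋₊)) atTop (𝓝 0) := by
    refine tendsto_sum_zero fun j _ => ?_
    refine tendsto_sum_zero fun T hT => ?_
    rw [Finset.mem_filter, Finset.mem_powerset] at hT
    -- C absorbs the rounding: at most one bit per ceiling and per floor.
    refine tendsto_two_pow_div (C := T.card + (usedIndices (K j ∪ A j) T).card)
      (hreg j T hT.1 hT.2) (fun n => ?_) fun n => ?_
    · exact (sum_ceil_le T hR n).trans (by simp)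
    · exact le_trans (by simp [usedIndices]) (le_sum_floor (usedIndices (K j ∪ A j) T) S n)
  have hlink' : Tendsto (fun n : ℕ => ∑ j,
      (2 : ℝ) ^ (∑ J ∈ Finset.univ.filter (fun J => ¬ J ⊆ A j), ⌊(n : ℝ) * S J⌋₊) / 2 ^ n)
      atTop (𝓝 0) := by
    refine tendsto_sum_zero fun j _ => ?_
    exact tendsto_two_pow_div (q := fun n => n) (C := 0) (hlink j)
      (fun n => (sum_floor_le _ hS n).trans (by simp)) fun n => by simp
  filter_upwards [hcomp.eventually_lt_const one_pos, hlink'.eventually_lt_const one_pos]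
    with n h1 h2
  exact exists_code_of_sum_lt_one _ _ K hK h1 h2

theorem achievable_of_eventually {N : ℕ} {A : Fin N → Finset (Fin N)} {R : Fin N → ℝ}
    (h : ∀ᶠ n in atTop, ∃ C : Code A (fun i => messageCount (R i) n) n, C.errorProb = 0) :
    Achievable A R := by
  classical
  -- A dummy code fills in at block lengths with no zero-error code.
  have hne : ∀ n, Nonempty (Code A (fun i => messageCount (R i) n) n) := fun n =>
    ⟨⟨fun _ _ => false, fun j _ _ => ⟨0, Nat.two_pow_pos _⟩⟩⟩
  have hex : ∀ n, ∃ C : Code A (fun i => messageCount (R i) n) n,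
      (∃ C' : Code A (fun i => messageCount (R i) n) n, C'.errorProb = 0) → C.errorProb = 0 := by
    intro n
    by_cases hn : ∃ C' : Code A (fun i => messageCount (R i) n) n, C'.errorProb = 0
    · exact ⟨hn.choose, fun _ => hn.choose_spec⟩
    · exact ⟨(hne n).some, fun hn' => absurd hn' hn⟩
  choose C hC using hex
  exact ⟨C, tendsto_const_nhds.congr' (h.mono fun n hn => (hC n hn).symm)⟩

/-- The region constraints are strict and finite in number, so they survive scaling the composite
rates by some factor less than one. -/
theorem exists_scaling {N : ℕ} {A K : Fin N → Finset (Fin N)} {R : Fin N → ℝ}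
    {S : Finset (Fin N) → ℝ} (hreg : ∀ j, R ∈ polymatroidRegion S (K j) (A j)) :
    ∃ c : ℝ, 0 < c ∧ c < 1 ∧ ∀ j, R ∈ polymatroidRegion (fun J => c * S J) (K j) (A j) := by
  have hev : ∀ᶠ c : ℝ in 𝓝[<] 1, ∀ j, R ∈ polymatroidRegion (fun J => c * S J) (K j) (A j) := by
    refine eventually_all.2 fun j => eventually_all.2 fun T => ?_
    by_cases hT : T ⊆ K j \ A j ∧ T.Nonempty
    · have hcont : Tendsto (fun c : ℝ => c * ∑ J ∈ Finset.univ.filter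
          (fun J : Finset (Fin N) => J ⊆ K j ∪ A j ∧ (J ∩ T).Nonempty), S J) (𝓝[<] 1)
          (𝓝 (1 * ∑ J ∈ Finset.univ.filter
          (fun J : Finset (Fin N) => J ⊆ K j ∪ A j ∧ (J ∩ T).Nonempty), S J)) :=
        ((continuous_id.mul continuous_const).tendsto _).mono_left nhdsWithin_le_nhds
      rw [one_mul] at hcont
      filter_upwards [hcont.eventually_const_lt (hreg j T hT.1 hT.2)] with c hc _ _
      rwa [← Finset.mul_sum]
    · exact Eventually.of_forall fun c h1 h2 => absurd ⟨h1, h2⟩ hT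
  obtain ⟨c, hc, hc0, hc1⟩ := (hev.and (Ioo_mem_nhdsLT (zero_lt_one' ℝ))).exists
  exact ⟨c, hc0, hc1, hc⟩

end IndexCoding

/-- **Composite-coding inner bound** for the index coding problem `(j | A j)`. -/
theorem theorem2 {N : ℕ} (A : Fin N → Finset (Fin N)) (hA : ∀ j, j ∉ A j)
    (R : Fin N → ℝ) (hR : ∀ j, 0 ≤ R j)
    (h : ∃ S : Finset (Fin N) → ℝ,
      (∀ J, 0 ≤ S J) ∧
      (∀ j, ∑ J ∈ Finset.univ.filter (fun J : Finset (Fin N) => ¬ J ⊆ A j), S J ≤ 1) ∧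
      R ∈ ⋂ j : Fin N, ⋃ K ∈ {K : Finset (Fin N) | j ∈ K},
        IndexCoding.polymatroidRegion S K (A j)) :
    IndexCoding.Achievable A R := by
  obtain ⟨S, hS, hlink, hmem⟩ := h
  simp only [Set.mem_iInter, Set.mem_iUnion, Set.mem_ofPred_eq, exists_prop] at hmem
  choose K hK hreg using hmem
  -- Scaling by c < 1 turns the link bound ≤ 1 into the strict one needed.
  obtain ⟨c, hc0, hc1, hc⟩ := IndexCoding.exists_scaling hreg
  refine IndexCoding.achievable_of_eventually (IndexCoding.eventually_exists_code hK hR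
    (fun J => mul_nonneg hc0.le (hS J)) (fun j => ?_) hc)
  rw [← Finset.mul_sum]
  nlinarith [hlink j]
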